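/- **Setting.** Let $n,d\in\mathbb N$. A *latent SCM* over a DAG $G$ on $[n]$ consists of structural equations $V_i:=f_i(\mathbf V_{\mathrm{pa}(i)},U_i)$, $i\in[n]$, with $V_i$ real-valued, where $\mathrm{pa}(i)$ are the parents of $i$ in $G$ and the exogenous real random variables $U_1,\dots,U_n$ are mutually independent. It induces a distribution $P_{\mathbf V}$ on $\mathbb R^n$, and its $i$-th *mechanism* $p_i(\,\cdot\mid \mathbf v_{\mathrm{pa}(i)})$ is the law of $f_i(\mathbf v_{\mathrm{pa}(i)},U_i)$. A *multi-environment latent model* over $G$ with environments $\mathcal E$ consists of a latent SCM over $G$, whose distribution $P_{\mathbf V}$ has a Lebesgue density and is faithful to $G$ (whenever $\mathbf V_A\perp\mathbf V_B\mid\mathbf V_C$ under $P_{\mathbf V}$ for pairwise disjoint $A,B,C\subseteq[n]$, then $A$ and $B$ are d-separated by $C$ in $G$), together with, for each $e\in\mathcal E$, a distribution $P^e_{\mathbf V}$ that results from this SCM by a perfect stochastic intervention on a set $\mathcal I^e\subseteq[n]$ of mechanisms: the mechanisms of $i\in\mathcal I^e$ are replaced by mechanisms $p^e_i(v_i)$ that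 do not depend on the parents, and all other mechanisms are unchanged. **Theorem (identifiability up to $\sim_{\mathrm{CRL}}$ from two paired perfect stochastic interventions per node).** Let $G$ be a DAG on $[n]$ and let $(P^e_{\mathbf V})_{e\in\mathcal E}$ be the environment distributions of a multi-environment latent model over $G$ with unknown targets $\mathcal I^e$. Let $f:\mathbb R^n\to\mathbb R^d$ be a diffeomorphism onto its image $\mathcal X$ (that is, $f$ is injective, and $f$ and $f^{-1}:\mathcal X\to\mathbb R^n$ are $C^1$), and let $P^e_{\mathbf X}=f_*(P^e_{\mathbf V})$ for each $e\in\mathcal E$. Let $(h,G')$ be a candidate solution: $G'$ is a DAG on $[n]$; $h:\mathcal X\to\mathbb R^n$ is bijective and $h^{-1}:\mathbb R^n\to\mathbb R^d$ is a diffeomorphism onto its image $\mathcal X$; and the distributions $Q^e_{\mathbf Z}=h_*(P^e_{\mathbf X})$, $e\in\mathcal E$, are the environment distributions of some multi-environment latent model over $G'$, with targets $\mathcal J^e\subseteq[n]$. Assume: * (A1) for all $e\in\mathcal E$, $P^e_{\mathbf V}$ and $Q^e_{\mathbf Z}$ have continuously differentiable densities that are positive on all of $\mathbb R^n$; * (A2')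 there are known pairs of environments $(e_j,e_j')_{j=1}^m$ such that the two environments of each pair are interventions on the same, unknown, single node: for each $j$ there are $i$ and $k$ in $[n]$ with $\mathcal I^{e_j}=\mathcal I^{e_j'}=\{i\}$ and $\mathcal J^{e_j}=\mathcal J^{e_j'}=\{k\}$; and for each $i\in[n]$ there is at least one $j$ with $\mathcal I^{e_j}=\mathcal I^{e_j'}=\{i\}$; * (A3') for each $i\in[n]$, for at least one such pair $j$, the two intervened mechanisms of $V_i$ have positive densities $\tilde p_i$ (in $e_j$) and $\tilde{\tilde p}_i$ (in $e_j'$) whose ratio is differentiable with $(\tilde{\tilde p}_i/\tilde p_i)'(v)\neq0$ for all $v\in\mathbb R$. Then $(f^{-1},G)\sim_{\mathrm{CRL}}(h,G')$: there are a permutation $\pi$ of $[n]$ that is a graph isomorphism from $G$ to $G'$ (that is, $i\to j$ in $G$ if and only if $\pi(i)\to\pi(j)$ in $G'$) and $C^1$-diffeomorphisms $\phi_1,\dots,\phi_n$ of $\mathbb R$ such that $$h(x)_{\pi(i)}=\phi_i\big(f^{-1}(x)_i\big)\qquad\text{for all }x\in\mathcal X,\ i\in[n].$$ -/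

import Mathlib

open MeasureTheory ProbabilityTheory Set
open scoped Manifold ENNReal

/-! ### Directed acyclic graphs and d-separation -/

/-- A directed acyclic graph on the vertex set `Fin n`. -/
structure DAG (n : ℕ) extends Digraph (Fin n) where
  acyclic : ∀ i, ¬ Relation.TransGen Adj i i

namespace DAG

variable {n : ℕ} (G : DAG n)

theorem wellFounded_adj : WellFounded G.Adj := by
  have : Std.Irrefl (Relation.TransGen G.Adj) := ⟨G.acyclic⟩
  have h : WellFounded (Relation.TransGen G.Adj) := Finite.wellFounded_of_trans_of_irrefl _
  exact Subrelation.wf (fun h => Relation.TransGen.single h) h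

/-- The (index type of the) parents of the vertex `i`. -/
abbrev Pa (i : Fin n) : Type := {j : Fin n // G.Adj j i}

/-- A path of the undirected skeleton of `G` (a list of distinct, consecutively adjacent vertices)
which is not blocked by `C`: every collider on it has a descendant (possibly itself) in `C`, and
no other interior vertex of it lies in `C`. -/
structure IsActivePath (C : Finset (Fin n)) (p : List (Fin n)) : Prop where
  nodup : p.Nodup
  chain : p.IsChain (fun a b => G.Adj a b ∨ G.Adj b a)
  collider : ∀ a b c, [a, b, c] <:+: p → (G.Adj a b ∧ G.Adj c b) →
    ∃ x ∈ C, Relation.ReflTransGen G.Adj b x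
  nonCollider : ∀ a b c, [a, b, c] <:+: p → ¬ (G.Adj a b ∧ G.Adj c b) → b ∉ C

/-- `A` and `B` are d-separated by `C`: every path from `A` to `B` is blocked by `C`. -/
def DSep (A B C : Finset (Fin n)) : Prop :=
  ∀ a ∈ A, ∀ b ∈ B, ∀ p : List (Fin n),
    p.head? = some a → p.getLast? = some b → ¬ G.IsActivePath C p

end DAG

/-! ### Latent structural causal models -/

/-- A structural causal model with causal diagram `G`: structural equations
`V i := f i (V_pa(i), U i)` and jointly independent exogenous variables `U i ∼ noise i`. -/
structure LatentSCM {n : ℕ} (G : DAG n) where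
  f : ∀ i : Fin n, (G.Pa i → ℝ) → ℝ → ℝ
  measurable_f : ∀ i, Measurable (fun x : (G.Pa i → ℝ) × ℝ => f i x.1 x.2)
  noise : Fin n → Measure ℝ
  isProbabilityMeasure_noise : ∀ i, IsProbabilityMeasure (noise i)

namespace LatentSCM

variable {n : ℕ} {G : DAG n} (M : LatentSCM G)

instance (i : Fin n) : IsProbabilityMeasure (M.noise i) := M.isProbabilityMeasure_noise i

/-- The reduced form `V = f_RF(U)`, by recursive substitution of the structural equations. -/
noncomputable def reducedForm (u : Fin n → ℝ) : Fin n → ℝ :=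
  G.wellFounded_adj.fix (fun i V => M.f i (fun j => V j.1 j.2) (u i))

theorem reducedForm_eq (u : Fin n → ℝ) (i : Fin n) :
    M.reducedForm u i = M.f i (fun j => M.reducedForm u j.1) (u i) := by
  unfold reducedForm
  rw [WellFounded.fix_eq]

theorem measurable_reducedForm : Measurable M.reducedForm := by
  refine measurable_pi_lambda _ fun i => ?_
  induction i using G.wellFounded_adj.induction with
  | _ i ih =>
    have h : (fun u => M.reducedForm u i) =
        fun u => M.f i (fun j : G.Pa i => M.reducedForm u j.1) (u i) :=
      funext fun u => M.reducedForm_eq u i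
    rw [h]
    exact (M.measurable_f i).comp
      ((measurable_pi_lambda _ fun j : G.Pa i => ih j.1 j.2).prodMk (measurable_pi_apply i))

/-- The distribution `P_V` of the endogenous variables: the pushforward of the product
distribution `P_U` under the reduced form. -/
noncomputable def law : Measure (Fin n → ℝ) :=
  (Measure.pi M.noise).map M.reducedForm

instance : IsProbabilityMeasure M.law :=
  Measure.isProbabilityMeasure_map M.measurable_reducedForm.aemeasurable

/-- The causal mechanism `p_i(· | w)` of `V i`, as a probability measure on `ℝ`: the law of
`f i (w, U i)`, where `w` is a value of the parents of `V i`. -/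
noncomputable def mechanism (i : Fin n) (w : G.Pa i → ℝ) : Measure ℝ :=
  (M.noise i).map (M.f i w)

end LatentSCM

/-- `V_A` and `V_B` are conditionally independent given `V_C` under `P`. -/
def CondIndepCoords {n : ℕ} (P : Measure (Fin n → ℝ)) [IsFiniteMeasure P]
    (A B C : Finset (Fin n)) : Prop :=
  CondIndepFun (MeasurableSpace.comap (C.restrict (π := fun _ => ℝ)) inferInstance)
    (Finset.measurable_restrict C).comap_le
    (A.restrict (π := fun _ => ℝ)) (B.restrict (π := fun _ => ℝ)) P

/-- Faithfulness: the only conditional independences of `P` are those given by d-separation in `G`,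
that is, those implied by the local Markov conditions of `G`. -/
def IsFaithful {n : ℕ} (P : Measure (Fin n → ℝ)) [IsFiniteMeasure P] (G : DAG n) : Prop :=
  ∀ A B C : Finset (Fin n), Disjoint A B → Disjoint A C → Disjoint B C →
    CondIndepCoords P A B C → G.DSep A B C

/-! ### Densities -/

/-- `p` is a density of `μ` with respect to Lebesgue measure. -/
structure IsDensity {X : Type*} [MeasureSpace X] (μ : Measure X) (p : X → ℝ) : Prop where
  measurable : Measurable p
  nonneg : ∀ x, 0 ≤ p x
  eq_withDensity : μ = volume.withDensity (fun x => ENNReal.ofReal (p x))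

/-- `P` has a continuously differentiable density which is positive on all of `ℝⁿ`. -/
def HasC1FullySupportedDensity {n : ℕ} (P : Measure (Fin n → ℝ)) : Prop :=
  ∃ p : (Fin n → ℝ) → ℝ, ContDiff ℝ 1 p ∧ (∀ v, 0 < p v) ∧ IsDensity P p

/-! ### Multiple environments -/

/-- A latent causal model over `G` together with a family of environments `e : E`, each of which
results from the unintervened model `obs` by a perfect stochastic intervention on the mechanisms in
the set `target e`. -/
structure MultiEnvModel {n : ℕ} (G : DAG n) (E : Type*) where
  obs : LatentSCM G
  env : E → LatentSCM G
  target : E → Finset (Fin n)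
  /-- Mechanisms that are not intervened upon are those of the unintervened model. -/
  shared : ∀ e, ∀ j ∉ target e, ∀ w, (env e).mechanism j w = obs.mechanism j w
  /-- Interventions are perfect: intervened mechanisms do not depend on the parents. -/
  perfect : ∀ e, ∀ i ∈ target e, ∀ w w', (env e).mechanism i w = (env e).mechanism i w'
  /-- The distribution `P_V` induced by the unintervened model has a Lebesgue density. -/
  obs_absolutelyContinuous : obs.law ≪ volume
  /-- The distribution `P_V` induced by the unintervened model is faithful to `G`. -/
  obs_faithful : IsFaithful obs.law G

namespace MultiEnvModel

variable {n : ℕ} {G : DAG n} {E : Type*} (M : MultiEnvModel G E)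

/-- The environments `e` and `e'` are interventions on the single node `i`. -/
def IsPairOn (e e' : E) (i : Fin n) : Prop :=
  M.target e = {i} ∧ M.target e' = {i}

/-- The mechanisms of `V i` in the environments `e` and `e'` (in both of which they do not depend
on the parents of `V i`) have positive densities `a` and `b` whose ratio `b / a` has a
derivative that vanishes nowhere. -/
def DistinctMechanisms (e e' : E) (i : Fin n) : Prop :=
  ∃ a b : ℝ → ℝ, (∀ v, 0 < a v) ∧ (∀ v, 0 < b v) ∧
    (∀ w, IsDensity ((M.env e).mechanism i w) a) ∧
    (∀ w, IsDensity ((M.env e').mechanism i w) b) ∧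
    ∀ v, DifferentiableAt ℝ (fun t => b t / a t) v ∧ deriv (fun t => b t / a t) v ≠ 0

end MultiEnvModel

/-! ### Mixing and unmixing functions, and the identifiability class -/

/-- `f : ℝⁿ → ℝᵈ` is a diffeomorphism onto its image: it is injective, and `f` and its inverse
`f⁻¹ : Im f → ℝⁿ` are continuously differentiable. -/
structure IsDiffeoOntoImage {n d : ℕ} (f : (Fin n → ℝ) → (Fin d → ℝ)) : Prop where
  contDiff : ContDiff ℝ 1 f
  injective : Function.Injective f
  contDiffOn_inv : ContDiffOn ℝ 1 (Function.invFun f) (range f)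

/-- `h` restricts to a bijection from `𝒳` onto `ℝⁿ` whose inverse `h⁻¹ : ℝⁿ → 𝒳 ⊆ ℝᵈ` is a
diffeomorphism onto its image `𝒳`. Only the values of `h` on `𝒳` matter. -/
def IsUnmixing {n d : ℕ} (𝒳 : Set (Fin d → ℝ)) (h : (Fin d → ℝ) → (Fin n → ℝ)) : Prop :=
  ∃ g : (Fin n → ℝ) → (Fin d → ℝ), IsDiffeoOntoImage g ∧ range g = 𝒳 ∧ ∀ z, h (g z) = z

/-- `(h₁, G₁) ∼_CRL (h₂, G₂)` for unmixing functions on `𝒳`: there are a graph isomorphism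
`σ : G₁ → G₂` and an element-wise diffeomorphism `φ` of `ℝⁿ` such that `h₂ = P_{σ⁻¹} ∘ φ ∘ h₁`
on `𝒳`, i.e. coordinate `σ i` of `h₂` is `φ i` applied to coordinate `i` of `h₁`. -/
def CRLEquiv {n d : ℕ} (𝒳 : Set (Fin d → ℝ))
    (s₁ s₂ : ((Fin d → ℝ) → (Fin n → ℝ)) × DAG n) : Prop :=
  ∃ (σ : Equiv.Perm (Fin n)) (φ : Fin n → Diffeomorph 𝓘(ℝ, ℝ) 𝓘(ℝ, ℝ) ℝ ℝ 1),
    (∀ i j, s₁.2.Adj i j ↔ s₂.2.Adj (σ i) (σ j)) ∧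
    ∀ x ∈ 𝒳, ∀ i, s₂.1 x (σ i) = φ i (s₁.1 x i)

/-!
Let `ψ = h ∘ f` be the `C¹` diffeomorphism of `ℝⁿ` that carries the true latents to the candidate
latents, and the law of every environment of the first model to that of the second.

*Coordinates.* For a pair of environments that intervene on the single node `i` of the true model
and `k` of the candidate, all factors but one of the Markov factorization cancel in the likelihood
ratio: it is `r (v i)` in the true latents and a function of `z k` in the candidate latents
(`MultiEnvModel.law_env_eq_withDensity`). As `r` is continuous with a derivative that vanishes
nowhere, it is injective, so `ψ⁻¹ (z) i` is a function of `z k` alone (`dependsOn_of_isPairOn`).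
The resulting map `i ↦ k` is onto, since a coordinate outside its range would not influence `ψ⁻¹`;
hence it is a permutation `σ`, and `ψ` is `σ` composed with an element-wise diffeomorphism
(`exists_perm_diffeomorph`).

*Graph.* Write `p j` for the density of the `j`-th mechanism of the true model and `q j` for that of
the mechanism `σ j` of the candidate, in the coordinates of the true model. The environment that
intervenes on `i` has the density `a i * ∏ j ≠ i, p j = a i * ∏ j ≠ i, q j`, with the same factor
`a i`, which is the density of the `i`-th marginal. For `n ≥ 2`, multiplying these identities over
all `i` gives `∏ j, p j = ∏ j, q j`, and hence `p k = q k` for each `k` (`mechDensity_ae_eq`). By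
faithfulness, `p k` depends on each parent of `k`: otherwise `V k` would be independent of a parent
given the other parents (`MultiEnvModel.not_adj_of_mechDensity_ae_eq`). So the parents of `k` and of
`σ k` correspond to each other. Only the laws of the environments are compared; the observational
law need not be among them, and enters through faithfulness alone.

Densities are taken with respect to a product probability measure `γ` equivalent to Lebesgue measure,
and on the candidate side with respect to the image of `γ` under `ψ`, so that no Jacobian appears.
Mechanisms have densities because the laws do (`LatentSCM.mechanism_absolutelyContinuous`), and the
Markov factorization follows by adding the nodes in a topological order
(`LatentSCM.law_eq_withDensity_prod`).
-/

/-! ### Product measures and resampling one coordinate -/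

/-- Resampling the coordinate `k` of a product probability measure does not change it. -/
theorem measurePreserving_update {n : ℕ} (γ : Fin n → Measure ℝ) [∀ i, IsProbabilityMeasure (γ i)]
    (k : Fin n) :
    MeasurePreserving (fun p : (Fin n → ℝ) × ℝ => Function.update p.1 k p.2)
      ((Measure.pi γ).prod (γ k)) (Measure.pi γ) := by
  have hmeas : Measurable (fun p : (Fin n → ℝ) × ℝ => Function.update p.1 k p.2) :=
    measurable_update'
  refine ⟨hmeas, (Measure.pi_eq fun s hs => ?_).symm⟩
  rw [Measure.map_apply hmeas (MeasurableSet.univ_pi hs)]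
  have h : (fun p : (Fin n → ℝ) × ℝ => Function.update p.1 k p.2) ⁻¹' (univ.pi s) =
      (univ.pi (Function.update s k univ)) ×ˢ s k := by
    ext p
    simp only [mem_preimage, mem_pi, mem_univ, true_imp_iff, mem_prod]
    constructor
    · intro H
      refine ⟨fun i => ?_, by simpa using H k⟩
      rcases eq_or_ne i k with rfl | hi
      · simp
      · simpa [hi] using H i
    · rintro ⟨H1, H2⟩ i
      rcases eq_or_ne i k with rfl | hi
      · simpa using H2
      · simpa [hi] using H1 i
  rw [h, Measure.prod_prod, Measure.pi_pi, ← Finset.mul_prod_erase _ _ (Finset.mem_univ k),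
    ← Finset.mul_prod_erase _ (fun i => γ i (s i)) (Finset.mem_univ k)]
  simp only [Function.update_self, measure_univ, one_mul]
  rw [mul_comm]
  congr 1
  refine Finset.prod_congr rfl fun i hi => ?_
  rw [Function.update_of_ne (Finset.ne_of_mem_erase hi)]

theorem lintegral_lintegral_update {n : ℕ} (γ : Fin n → Measure ℝ)
    [∀ i, IsProbabilityMeasure (γ i)] (k : Fin n) {F : (Fin n → ℝ) → ℝ≥0∞} (hF : Measurable F) :
    ∫⁻ v, ∫⁻ t, F (Function.update v k t) ∂(γ k) ∂(Measure.pi γ) = ∫⁻ v, F v ∂(Measure.pi γ) := by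
  rw [← (measurePreserving_update γ k).lintegral_comp hF, lintegral_prod]
  exact (hF.comp measurable_update').aemeasurable

/-- An almost sure property is inherited by almost every resampling of the coordinate `k`. -/
theorem ae_ae_update {n : ℕ} (γ : Fin n → Measure ℝ) [∀ i, IsProbabilityMeasure (γ i)]
    (k : Fin n) {p : (Fin n → ℝ) → Prop} (hp : ∀ᵐ v ∂(Measure.pi γ), p v) :
    ∀ᵐ v ∂(Measure.pi γ), ∀ᵐ t ∂(γ k), p (Function.update v k t) :=
  Measure.ae_ae_of_ae_prod ((measurePreserving_update γ k).quasiMeasurePreserving.ae hp)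

theorem MeasureTheory.Measure.AbsolutelyContinuous.pi_fin : ∀ {n : ℕ} {μ ν : Fin n → Measure ℝ}
    [∀ i, SigmaFinite (μ i)] [∀ i, SigmaFinite (ν i)] (_ : ∀ i, μ i ≪ ν i),
    Measure.pi μ ≪ Measure.pi ν
  | 0, μ, ν, _, _, _ => by
    rw [Measure.pi_of_empty μ 0, Measure.pi_of_empty ν 0]
  | n + 1, μ, ν, _, _, h => by
    have hμ := measurePreserving_piFinSuccAbove μ 0
    have hν := measurePreserving_piFinSuccAbove ν 0
    have := (h 0).prod (AbsolutelyContinuous.pi_fin fun i : Fin n => h ((0 : Fin (n + 1)).succAbove i))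
    rw [← hμ.symm.map_eq, ← hν.symm.map_eq]
    exact this.map (MeasurableEquiv.measurable _)

/-- There is a product probability measure on `ℝⁿ` which is equivalent to Lebesgue measure. -/
theorem exists_pi_equivalent_volume (n : ℕ) : ∃ γ : Fin n → Measure ℝ,
    (∀ i, IsProbabilityMeasure (γ i)) ∧ (∀ i, (γ i).IsOpenPosMeasure) ∧
      volume ≪ Measure.pi γ ∧ Measure.pi γ ≪ volume :=
  ⟨fun _ => gaussianReal 0 1, fun _ => inferInstance,
    fun _ => (gaussianReal_absolutelyContinuous' 0 one_ne_zero).isOpenPosMeasure,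
    .pi_fin fun _ => gaussianReal_absolutelyContinuous' 0 one_ne_zero,
    .pi_fin fun _ => gaussianReal_absolutelyContinuous 0 one_ne_zero⟩

/-- If a continuous function agrees almost everywhere with a function which does not depend on the
coordinate `l`, then it does not depend on the coordinate `l` either. -/
theorem Continuous.update_eq_of_ae_eq {n : ℕ} (γ : Fin n → Measure ℝ)
    [∀ i, IsProbabilityMeasure (γ i)] [(Measure.pi γ).IsOpenPosMeasure]
    {R F : (Fin n → ℝ) → ℝ} (hR : Continuous R)
    (h : R =ᵐ[Measure.pi γ] F) {l : Fin n} [(γ l).IsOpenPosMeasure]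
    (hF : ∀ v t, F (Function.update v l t) = F v) (v : Fin n → ℝ) (t : ℝ) :
    R (Function.update v l t) = R v := by
  have h1 : ∀ᵐ p ∂((Measure.pi γ).prod (γ l)), R (Function.update p.1 l p.2) = R p.1 := by
    filter_upwards [(measurePreserving_update γ l).quasiMeasurePreserving.ae h,
      Measure.quasiMeasurePreserving_fst.ae h] with p hp1 hp2
    rw [hp1, hp2, hF]
  have h2 : (fun p : (Fin n → ℝ) × ℝ => R (Function.update p.1 l p.2)) = fun p => R p.1 :=
    Continuous.ae_eq_iff_eq ((Measure.pi γ).prod (γ l))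
      (hR.comp (continuous_fst.update l continuous_snd)) (hR.comp continuous_fst) |>.1 h1
  exact congrFun h2 (v, t)

/-- A function which does not change when a coordinate outside `s` changes depends only on the
coordinates in `s`. -/
theorem dependsOn_of_forall_update {n : ℕ} {β : Type*} {R : (Fin n → ℝ) → β} {s : Set (Fin n)}
    (h : ∀ l ∉ s, ∀ v t, R (Function.update v l t) = R v) : DependsOn R s := by
  intro x y hxy
  have key : ∀ A : Finset (Fin n), R (A.piecewise y x) = R x := by
    intro A
    induction A using Finset.induction_on with
    | empty => simp
    | insert l A _ ih =>
      rw [Finset.piecewise_insert]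
      by_cases hl : l ∈ s
      · rw [← hxy l hl]
        rw [← ih]
        congr 1
        refine Function.update_eq_iff.2 ⟨?_, fun _ _ => rfl⟩
        by_cases hA : l ∈ A <;> simp [hA, hxy l hl]
      · rw [h l hl, ih]
  simpa using (key Finset.univ).symm

theorem DependsOn.apply_update {n : ℕ} {β : Type*} {R : (Fin n → ℝ) → β} {s : Set (Fin n)}
    (h : DependsOn R s) {l : Fin n} (hl : l ∉ s) (v : Fin n → ℝ) (t : ℝ) :
    R (Function.update v l t) = R v :=
  h fun i hi => Function.update_of_ne (by rintro rfl; exact hl hi) _ _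

/-! ### Ancestral factorization of the law of a structural causal model -/

/-- A set of vertices is ancestral if it contains the parents of its elements. -/
def DAG.IsAncestral {n : ℕ} (G : DAG n) (S : Set (Fin n)) : Prop :=
  ∀ j ∈ S, ∀ i, G.Adj i j → i ∈ S

namespace DAG

variable {n : ℕ} (G : DAG n)

theorem not_adj_self (i : Fin n) : ¬ G.Adj i i := fun h => G.acyclic i (.single h)

theorem ne_of_adj {i j : Fin n} (h : G.Adj i j) : i ≠ j := by
  rintro rfl
  exact G.not_adj_self i h

/-- The set of strict ancestors of `k`. -/
def ancestors (k : Fin n) : Set (Fin n) := {j | Relation.TransGen G.Adj j k}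

theorem isAncestral_ancestors (k : Fin n) : G.IsAncestral (G.ancestors k) :=
  fun _ hj _ hij => .head hij hj

theorem notMem_ancestors (k : Fin n) : k ∉ G.ancestors k := G.acyclic k

/-- A nonempty set of vertices has a sink: an element with no child in the set. -/
theorem exists_sink {S : Finset (Fin n)} (hS : S.Nonempty) :
    ∃ k ∈ S, ∀ j ∈ S, ¬ G.Adj k j := by
  have : Std.Irrefl (Function.swap (Relation.TransGen G.Adj)) := ⟨G.acyclic⟩
  have : IsTrans _ (Function.swap (Relation.TransGen G.Adj)) := ⟨fun _ _ _ h h' => h'.trans h⟩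
  have h : WellFounded (Function.swap (Relation.TransGen G.Adj)) :=
    Finite.wellFounded_of_trans_of_irrefl _
  obtain ⟨k, hk, hmin⟩ := h.has_min (S : Set (Fin n)) hS
  exact ⟨k, hk, fun j hj hkj => hmin j hj (.single hkj)⟩

/-- The restriction of a point to the parents of `k`. -/
def paVal (k : Fin n) (v : Fin n → ℝ) : G.Pa k → ℝ := fun j => v j.1

theorem measurable_paVal (k : Fin n) : Measurable (G.paVal k) :=
  measurable_pi_lambda _ fun j => measurable_pi_apply j.1

theorem paVal_congr {k : Fin n} {v w : Fin n → ℝ} (h : ∀ i, G.Adj i k → v i = w i) :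
    G.paVal k v = G.paVal k w := funext fun j => h j.1 j.2

theorem paVal_update (k : Fin n) (v : Fin n → ℝ) (t : ℝ) :
    G.paVal k (Function.update v k t) = G.paVal k v :=
  G.paVal_congr fun _ hi => Function.update_of_ne (G.ne_of_adj hi) _ _

end DAG

namespace LatentSCM

variable {n : ℕ} {G : DAG n} (M : LatentSCM G)

theorem measurable_f_right (k : Fin n) (w : G.Pa k → ℝ) : Measurable (M.f k w) :=
  (M.measurable_f k).comp measurable_prodMk_left

instance (k : Fin n) (w : G.Pa k → ℝ) : IsProbabilityMeasure (M.mechanism k w) :=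
  Measure.isProbabilityMeasure_map (M.measurable_f_right k w).aemeasurable

/-- The mechanism of `V k` as a Markov kernel. -/
noncomputable def mechKernel (k : Fin n) : Kernel (G.Pa k → ℝ) ℝ where
  toFun := M.mechanism k
  measurable' := by
    refine Measure.measurable_of_measurable_coe _ fun s hs => ?_
    have : ∀ w, M.mechanism k w s = M.noise k (Prod.mk w ⁻¹' ((fun x : (G.Pa k → ℝ) × ℝ =>
        M.f k x.1 x.2) ⁻¹' s)) := fun w => by
      rw [mechanism, Measure.map_apply (M.measurable_f_right k w) hs]; rfl
    simp_rw [this]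
    exact measurable_measure_prodMk_left (M.measurable_f k hs)

@[simp] theorem mechKernel_apply (k : Fin n) (w : G.Pa k → ℝ) :
    M.mechKernel k w = M.mechanism k w := rfl

instance (k : Fin n) : IsMarkovKernel (M.mechKernel k) :=
  ⟨fun w => inferInstanceAs (IsProbabilityMeasure (M.mechanism k w))⟩

theorem reducedForm_congr {S : Set (Fin n)} (hS : G.IsAncestral S) {u u' : Fin n → ℝ}
    (h : ∀ i ∈ S, u i = u' i) : ∀ i ∈ S, M.reducedForm u i = M.reducedForm u' i := by
  intro i
  induction i using G.wellFounded_adj.induction with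
  | _ i ih =>
    intro hi
    rw [M.reducedForm_eq u, M.reducedForm_eq u', h i hi]
    congr 1
    exact funext fun j => ih j.1 j.2 (hS i hi j.1 j.2)

theorem measurable_lintegral_mechanism_update (k : Fin n) {F : (Fin n → ℝ) → ℝ≥0∞}
    (hF : Measurable F) :
    Measurable fun v => ∫⁻ t, F (Function.update v k t) ∂(M.mechanism k (G.paVal k v)) := by
  have h := Measurable.lintegral_kernel_prod_right
    (κ := (M.mechKernel k).comap (G.paVal k) (G.measurable_paVal k))
    (f := fun v t => F (Function.update v k t)) (hF.comp measurable_update')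
  simpa using h

/-- The mechanism of `V k` is the conditional distribution of `V k` given its nondescendants:
the law of `(V_S, V k)`, for an ancestral set `S` which contains the parents of `k` but not `k`, is
obtained from the law of `V_S` by sampling `V k` from its mechanism. -/
theorem lintegral_law_eq_lintegral_mechanism {S : Set (Fin n)} (hS : G.IsAncestral S) {k : Fin n}
    (hkS : k ∉ S) (hpa : ∀ i, G.Adj i k → i ∈ S) {F : (Fin n → ℝ) → ℝ≥0∞} (hF : Measurable F)
    (hdep : DependsOn F (insert k S)) :
    ∫⁻ v, F v ∂M.law =
      ∫⁻ v, ∫⁻ t, F (Function.update v k t) ∂(M.mechanism k (G.paVal k v)) ∂M.law := by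
  unfold law
  rw [lintegral_map hF M.measurable_reducedForm,
    lintegral_map (M.measurable_lintegral_mechanism_update k hF) M.measurable_reducedForm,
    ← lintegral_lintegral_update M.noise k (F := fun u => F (M.reducedForm u))
      (hF.comp M.measurable_reducedForm)]
  refine lintegral_congr fun u => ?_
  rw [mechanism, lintegral_map (f := fun t => F (Function.update (M.reducedForm u) k t))
    (hF.comp (measurable_update _)) (M.measurable_f_right k _)]
  refine lintegral_congr fun s => hdep ?_
  have hT := M.reducedForm_congr hS (u := Function.update u k s) (u' := u) fun i hi =>
    Function.update_of_ne (by rintro rfl; exact hkS hi) _ _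
  rintro i (rfl | hi)
  · rw [M.reducedForm_eq, Function.update_self, Function.update_self]
    congr 1
    exact funext fun j => hT j.1 (hpa j.1 j.2)
  · rw [Function.update_of_ne (by rintro rfl; exact hkS hi), hT i hi]

theorem law_map_eval {k : Fin n} {α : Measure ℝ} (hα : ∀ w, M.mechanism k w = α) :
    M.law.map (fun v => v k) = α := by
  ext s hs
  rw [← lintegral_indicator_one hs, lintegral_map (measurable_one.indicator hs)
    (measurable_pi_apply k), M.lintegral_law_eq_lintegral_mechanism (G.isAncestral_ancestors k)
    (G.notMem_ancestors k) (fun i hi => .single hi)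
    (F := fun v => s.indicator 1 (v k)) ((measurable_one.indicator hs).comp (measurable_pi_apply k))
    (fun x y h => by simp only [h k (mem_insert _ _)])]
  simp [hα, lintegral_indicator_one hs]

/-- If the mechanisms have densities `r j` with respect to `γ j`, then the law has the density
`∏ j, r j` with respect to the product measure of the `γ j`. The density `r j` is regarded as a
function on `ℝⁿ` which depends only on the coordinate `j` and the parents of `j`. -/
theorem law_eq_withDensity_prod (γ : Fin n → Measure ℝ) [∀ i, IsProbabilityMeasure (γ i)]
    (r : Fin n → (Fin n → ℝ) → ℝ≥0∞) (hr : ∀ j, Measurable (r j))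
    (hdep : ∀ j, DependsOn (r j) (insert j {i | G.Adj i j}))
    (hmech : ∀ j, ∀ᵐ v ∂M.law, M.mechanism j (G.paVal j v) =
      (γ j).withDensity fun t => r j (Function.update v j t)) :
    M.law = (Measure.pi γ).withDensity fun v => ∏ j, r j v := by
  classical
  -- the marginals on ancestral sets, by induction on the set
  have key : ∀ (m : ℕ) (S : Finset (Fin n)), S.card = m → G.IsAncestral S →
      ∀ F : (Fin n → ℝ) → ℝ≥0∞, Measurable F → DependsOn F S →
        ∫⁻ v, F v ∂M.law = ∫⁻ v, (∏ j ∈ S, r j v) * F v ∂(Measure.pi γ) := by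
    intro m
    induction m with
    | zero =>
      intro S hS _ F _ hFS
      have hF0 : F = fun _ => F 0 := funext fun v => hFS fun i hi => by
        simp [Finset.card_eq_zero.1 hS] at hi
      rw [Finset.card_eq_zero.1 hS, hF0]
      simp
    | succ m ih =>
      intro S hcard hS F hF hFS
      obtain ⟨k, hk, hsink⟩ := G.exists_sink (Finset.card_pos.1 (by omega) : S.Nonempty)
      have hpa : ∀ i, G.Adj i k → i ∈ S.erase k := fun i hi =>
        Finset.mem_erase.2 ⟨G.ne_of_adj hi, hS k hk i hi⟩
      have hS' : G.IsAncestral (S.erase k : Finset (Fin n)) := fun j hj i hij => by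
        have hjS := Finset.mem_of_mem_erase hj
        refine Finset.mem_erase.2 ⟨?_, hS j hjS i hij⟩
        rintro rfl
        exact hsink j hjS hij
      have hins : insert k ((S.erase k : Finset (Fin n)) : Set (Fin n)) = S := by
        rw [← Finset.coe_insert, Finset.insert_erase hk]
      have hrk : Measurable fun v => r k v * F v := (hr k).mul hF
      have hG : Measurable fun v => ∫⁻ t, r k (Function.update v k t) *
          F (Function.update v k t) ∂(γ k) :=
        Measurable.lintegral_prod_right' (f := fun p : (Fin n → ℝ) × ℝ =>
          r k (Function.update p.1 k p.2) * F (Function.update p.1 k p.2))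
          (hrk.comp measurable_update')
      rw [M.lintegral_law_eq_lintegral_mechanism hS' (by simp) hpa hF (by rwa [hins])]
      have h1 : ∫⁻ v, ∫⁻ t, F (Function.update v k t) ∂(M.mechanism k (G.paVal k v)) ∂M.law =
          ∫⁻ v, ∫⁻ t, r k (Function.update v k t) * F (Function.update v k t) ∂(γ k) ∂M.law := by
        refine lintegral_congr_ae ?_
        filter_upwards [hmech k] with v hv
        rw [hv]
        exact lintegral_withDensity_eq_lintegral_mul _ ((hr k).comp (measurable_update _))
          (hF.comp (measurable_update _))
      have hdepG : DependsOn (fun v => ∫⁻ t, r k (Function.update v k t) *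
          F (Function.update v k t) ∂(γ k)) (S.erase k : Finset (Fin n)) := by
        intro x y hxy
        refine lintegral_congr fun t => ?_
        have hagree : ∀ i ∈ S, Function.update x k t i = Function.update y k t i := fun i hi => by
          rcases eq_or_ne i k with rfl | hik
          · simp
          · simpa [hik] using hxy i (Finset.mem_erase.2 ⟨hik, hi⟩)
        rw [hFS hagree, hdep k (x := Function.update x k t) (y := Function.update y k t)]
        rintro i (rfl | hi)
        · exact hagree _ hk
        · exact hagree _ (Finset.mem_of_mem_erase (hpa i hi))
      rw [h1, ih _ (by rw [Finset.card_erase_of_mem hk]; omega) hS' _ hG hdepG,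
        ← lintegral_lintegral_update γ k (F := fun v => (∏ j ∈ S, r j v) * F v)
          ((Finset.measurable_fun_prod S fun j _ => hr j).mul hF)]
      refine lintegral_congr fun v => ?_
      rw [← lintegral_const_mul (f := fun t => r k (Function.update v k t) *
        F (Function.update v k t)) _ (hrk.comp (measurable_update _))]
      refine lintegral_congr fun t => ?_
      -- the densities of the nodes other than the sink `k` do not involve the coordinate `k`
      have hprod : ∏ j ∈ S.erase k, r j (Function.update v k t) = ∏ j ∈ S.erase k, r j v := by
        refine Finset.prod_congr rfl fun j hj => (hdep j).apply_update ?_ _ _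
        rintro (rfl | h)
        · simp at hj
        · exact hsink j (Finset.mem_of_mem_erase hj) h
      rw [← Finset.mul_prod_erase _ _ hk, hprod]
      ring
  ext s hs
  rw [withDensity_apply _ hs, ← lintegral_indicator_one hs,
    key _ Finset.univ rfl (fun _ _ _ _ => Finset.mem_univ _) _ (measurable_one.indicator hs)
      (fun x y h => by rw [funext fun i => h i (Finset.mem_univ i)]),
    ← lintegral_indicator hs]
  refine lintegral_congr fun v => ?_
  by_cases hv : v ∈ s <;> simp [hv]

/-- If the law is absolutely continuous with respect to a product measure, then so are, almost
surely, the mechanisms with respect to its factors. -/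
theorem mechanism_absolutelyContinuous (γ : Fin n → Measure ℝ) [∀ i, IsProbabilityMeasure (γ i)]
    (hac : M.law ≪ Measure.pi γ) (k : Fin n) :
    ∀ᵐ v ∂M.law, M.mechanism k (G.paVal k v) ≪ γ k := by
  set η : Kernel (G.Pa k → ℝ) ℝ := Kernel.const _ (γ k)
  -- a measurable set whose slices carry the singular parts of the mechanism
  set N : Set (Fin n → ℝ) :=
    {v | (G.paVal k v, v k) ∈ Kernel.mutuallySingularSet (M.mechKernel k) η}
  have hN : MeasurableSet N := ((G.measurable_paVal k).prodMk (measurable_pi_apply k))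
    (Kernel.measurableSet_mutuallySingularSet _ _)
  have hslice : ∀ v, (fun t => Function.update v k t) ⁻¹' N =
      Kernel.mutuallySingularSetSlice (M.mechKernel k) η (G.paVal k v) := fun v => by
    ext t
    simp [N, DAG.paVal_update, Kernel.mutuallySingularSetSlice, Kernel.mutuallySingularSet]
  have hind : ∀ (v : Fin n → ℝ) (μ : Measure ℝ),
      ∫⁻ t, N.indicator 1 (Function.update v k t) ∂μ =
        μ (Kernel.mutuallySingularSetSlice (M.mechKernel k) η (G.paVal k v)) := fun v μ => by
    rw [← hslice v, ← lintegral_indicator_one ((measurable_update v) hN)]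
    rfl
  have h0 : (Measure.pi γ) N = 0 := by
    rw [← lintegral_indicator_one hN,
      ← lintegral_lintegral_update γ k (measurable_one.indicator hN)]
    simp only [hind]
    have : ∀ w, γ k (Kernel.mutuallySingularSetSlice (M.mechKernel k) η w) = 0 :=
      fun w => Kernel.measure_mutuallySingularSetSlice (M.mechKernel k) η w
    simp [this]
  have h1 := hac h0
  rw [← lintegral_indicator_one hN, M.lintegral_law_eq_lintegral_mechanism
    (G.isAncestral_ancestors k) (G.notMem_ancestors k) (fun i hi => .single hi)
    (measurable_one.indicator hN), lintegral_eq_zero_iff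
    (M.measurable_lintegral_mechanism_update k (measurable_one.indicator hN))] at h1
  · filter_upwards [h1] with v hv
    rw [Pi.zero_apply, hind] at hv
    have := (Kernel.singularPart_eq_zero_iff_measure_eq_zero (M.mechKernel k) η
      (G.paVal k v)).2 hv
    exact (Kernel.singularPart_eq_zero_iff_absolutelyContinuous (M.mechKernel k) η
      (G.paVal k v)).1 this
  · intro x y h
    have : x ∈ N ↔ y ∈ N := by
      simp only [N, mem_ofPred_eq]
      rw [h k (mem_insert _ _), G.paVal_congr fun i hi => h i (mem_insert_of_mem _ (.single hi))]
    by_cases hx : x ∈ N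
    · simp [hx, this.1 hx]
    · have hy : y ∉ N := fun hy => hx (this.2 hy)
      simp [hx, hy]

/-- A density of the mechanism of `V k` with respect to a measure `γ`, as a function on `ℝⁿ` which
depends only on the coordinate `k` and the parents of `k`. -/
noncomputable def mechDensity (γ : Measure ℝ) (k : Fin n) (v : Fin n → ℝ) : ℝ≥0∞ :=
  Kernel.rnDeriv (M.mechKernel k) (Kernel.const _ γ) (G.paVal k v) (v k)

theorem measurable_mechDensity (γ : Measure ℝ) (k : Fin n) : Measurable (M.mechDensity γ k) :=
  (Kernel.measurable_rnDeriv _ _).comp ((G.measurable_paVal k).prodMk (measurable_pi_apply k))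

theorem dependsOn_mechDensity (γ : Measure ℝ) (k : Fin n) :
    DependsOn (M.mechDensity γ k) (insert k {i | G.Adj i k}) := by
  intro x y h
  rw [mechDensity, mechDensity, h k (mem_insert _ _),
    G.paVal_congr fun i hi => h i (mem_insert_of_mem _ hi)]

theorem mechanism_eq_withDensity {γ : Measure ℝ} [IsProbabilityMeasure γ] {k : Fin n}
    {v : Fin n → ℝ} (h : M.mechanism k (G.paVal k v) ≪ γ) :
    M.mechanism k (G.paVal k v) =
      γ.withDensity fun t => M.mechDensity γ k (Function.update v k t) := by
  have := Kernel.withDensity_rnDeriv_eq (κ := M.mechKernel k) (η := Kernel.const _ γ) h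
  simp only [mechDensity, DAG.paVal_update, Function.update_self]
  rw [Kernel.withDensity_apply _ (Kernel.measurable_rnDeriv _ _)] at this
  exact this.symm

end LatentSCM

/-! ### Densities of the environments -/

namespace MultiEnvModel

variable {n : ℕ} {G : DAG n} {E : Type*} (M : MultiEnvModel G E)

/-- The law of an environment which intervenes on the single node `i` factorizes into the density
of the intervened mechanism and the densities of the observational mechanisms of the other nodes. -/
theorem law_env_eq_withDensity_prod (γ : Fin n → Measure ℝ) [∀ i, IsProbabilityMeasure (γ i)]
    {e : E} {i : Fin n} (he : M.target e = {i}) (hac : (M.env e).law ≪ Measure.pi γ)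
    {α : Measure ℝ} (hα : ∀ w, (M.env e).mechanism i w = α) {a : ℝ → ℝ≥0∞} (ha : Measurable a)
    (haα : α = (γ i).withDensity a) :
    (M.env e).law = (Measure.pi γ).withDensity fun v =>
      a (v i) * ∏ j ∈ Finset.univ.erase i, M.obs.mechDensity (γ j) j v := by
  have h := (M.env e).law_eq_withDensity_prod γ
    (fun j v => if j = i then a (v i) else M.obs.mechDensity (γ j) j v) (fun j => ?_) (fun j => ?_)
    (fun j => ?_)
  · rw [h]
    congr 1
    funext v
    rw [← Finset.mul_prod_erase _ _ (Finset.mem_univ i), if_pos rfl]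
    congr 1
    exact Finset.prod_congr rfl fun j hj => if_neg (Finset.ne_of_mem_erase hj)
  · by_cases hj : j = i
    · simp only [hj, if_true]
      exact ha.comp (measurable_pi_apply i)
    · simpa [hj] using M.obs.measurable_mechDensity (γ j) j
  · intro x y hxy
    by_cases hj : j = i
    · subst hj
      simp only [if_true, hxy j (mem_insert _ _)]
    · simpa [hj] using M.obs.dependsOn_mechDensity (γ j) j hxy
  · by_cases hj : j = i
    · subst hj
      refine ae_of_all _ fun v => ?_
      simp [hα, haα]
    · filter_upwards [(M.env e).mechanism_absolutelyContinuous γ hac j] with v hv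
      rw [M.shared e j (by simpa [he] using hj)] at hv ⊢
      simpa [hj] using M.obs.mechanism_eq_withDensity hv

/-- The laws of two environments which intervene on the same single node `k` differ by the ratio of
the two intervened mechanisms, which is a function of the coordinate `k`. -/
theorem law_env_eq_withDensity (γ : Fin n → Measure ℝ) [∀ i, IsProbabilityMeasure (γ i)]
    {e e' : E} {k : Fin n} (he : M.IsPairOn e e' k) (hac : (M.env e).law ≪ Measure.pi γ)
    (hac' : (M.env e').law ≪ Measure.pi γ) {α β : Measure ℝ}
    (hα : ∀ w, (M.env e).mechanism k w = α) (hβ : ∀ w, (M.env e').mechanism k w = β)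
    {ρ : ℝ → ℝ≥0∞} (hρ : Measurable ρ) (hαβ : β = α.withDensity ρ) :
    (M.env e').law = (M.env e).law.withDensity fun v => ρ (v k) := by
  have hαγ : α ≪ γ k := by
    rw [← (M.env e).law_map_eval hα]
    have := hac.map (measurable_pi_apply k)
    rwa [(measurePreserving_eval γ k).map_eq] at this
  have : IsProbabilityMeasure α := hα 0 ▸ inferInstance
  have ha : α = (γ k).withDensity (α.rnDeriv (γ k)) := (Measure.withDensity_rnDeriv_eq _ _ hαγ).symm
  have hm := Measure.measurable_rnDeriv α (γ k)
  have hb : β = (γ k).withDensity (α.rnDeriv (γ k) * ρ) := by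
    rw [withDensity_mul _ hm hρ, ← ha, hαβ]
  rw [M.law_env_eq_withDensity_prod γ he.1 hac hα hm ha,
    M.law_env_eq_withDensity_prod γ he.2 hac' hβ (hm.mul hρ) hb, ← withDensity_mul]
  · congr 1
    funext v
    simp only [Pi.mul_apply]
    ring
  · exact (hm.comp (measurable_pi_apply k)).mul
      (Finset.measurable_fun_prod _ fun j _ => M.obs.measurable_mechDensity (γ j) j)
  · exact hρ.comp (measurable_pi_apply k)

end MultiEnvModel

/-! ### Faithfulness: mechanisms depend on all parents -/

/-- Adjacent vertices are not d-separated by any set. -/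
theorem DAG.not_dSep_of_adj {n : ℕ} (G : DAG n) {i k : Fin n} (h : G.Adj i k)
    (C : Finset (Fin n)) : ¬ G.DSep {k} {i} C := by
  intro H
  have hno : ∀ a b c, ¬ [a, b, c] <:+: [k, i] := fun a b c h => by
    have := h.length_le
    simp at this
  refine H k (by simp) i (by simp) [k, i] rfl rfl ⟨?_, ?_, ?_, ?_⟩
  · simpa using (G.ne_of_adj h).symm
  · simpa using Or.inr h
  · exact fun a b c h => (hno a b c h).elim
  · exact fun a b c h => (hno a b c h).elim

theorem Set.indicator_one_congr {X : Type*} {A B : Set X} {x y : X} (h : x ∈ A ↔ y ∈ B) :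
    A.indicator (1 : X → ℝ≥0∞) x = B.indicator 1 y := by
  by_cases hx : x ∈ A
  · rw [indicator_of_mem hx, indicator_of_mem (h.1 hx)]
    rfl
  · rw [indicator_of_notMem hx, indicator_of_notMem fun hy => hx (h.2 hy)]

/-- The σ-algebra on `ℝⁿ` generated by the coordinates in `C`. -/
abbrev coordSigma {n : ℕ} (C : Finset (Fin n)) : MeasurableSpace (Fin n → ℝ) :=
  MeasurableSpace.comap (C.restrict (π := fun _ => ℝ)) inferInstance

/-- A measurable function which depends only on the coordinates in `C` is measurable with respect
to the σ-algebra generated by these coordinates. -/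
theorem DependsOn.measurable_comap_restrict {n : ℕ} {β : Type*} [MeasurableSpace β]
    {C : Finset (Fin n)} {H : (Fin n → ℝ) → β} (hH : Measurable H) (hdep : DependsOn H C) :
    Measurable[coordSigma C] H := by
  set ext : (C → ℝ) → Fin n → ℝ := fun w i => if h : i ∈ C then w ⟨i, h⟩ else 0
  have hext : Measurable ext := by
    refine measurable_pi_lambda _ fun i => ?_
    by_cases h : i ∈ C
    · simpa [ext, h] using measurable_pi_apply (⟨i, h⟩ : C)
    · simp [ext, h]
  have : H = (H ∘ ext) ∘ C.restrict (π := fun _ => ℝ) := by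
    funext v
    refine hdep fun i hi => ?_
    have hi' : i ∈ C := hi
    simp [ext, hi']
  rw [this]
  exact (hH.comp hext).comp (comap_measurable _)

/-- If the conditional distribution of `V k` given the strict ancestors of `k` has a density `g`
which depends only on the coordinates `k` and `C`, then `V k` is independent of each ancestor
given `V_C`. -/
theorem LatentSCM.condIndepCoords_of_mechanism {n : ℕ} {G : DAG n} (M : LatentSCM G)
    {γ : Measure ℝ} [IsProbabilityMeasure γ] {k i : Fin n} (hi : i ∈ G.ancestors k)
    {C : Finset (Fin n)} (hC : (C : Set (Fin n)) ⊆ G.ancestors k) {g : (Fin n → ℝ) → ℝ≥0∞}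
    (hg : Measurable g) (hdep : DependsOn g (insert k (C : Set (Fin n))))
    (hmech : ∀ᵐ v ∂M.law, M.mechanism k (G.paVal k v) =
      γ.withDensity fun t => g (Function.update v k t)) :
    CondIndepCoords M.law {k} {i} C := by
  have hm : coordSigma C ≤ MeasurableSpace.pi := (Finset.measurable_restrict C).comap_le
  have hkS := G.notMem_ancestors k
  refine (condIndepFun_iff_condExp_inter_preimage_eq_mul (Finset.measurable_restrict _)
    (Finset.measurable_restrict _)).2 fun s t hs ht => ?_
  set A : Set (Fin n → ℝ) := (({k} : Finset (Fin n)).restrict (π := fun _ => ℝ)) ⁻¹' s with hA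
  set B : Set (Fin n → ℝ) := (({i} : Finset (Fin n)).restrict (π := fun _ => ℝ)) ⁻¹' t with hB
  have hAm : MeasurableSet A := Finset.measurable_restrict _ hs
  have hBm : MeasurableSet B := Finset.measurable_restrict _ ht
  have hAdep : ∀ x y : Fin n → ℝ, x k = y k → (x ∈ A ↔ y ∈ A) := fun x y h => by
    have : ({k} : Finset (Fin n)).restrict (π := fun _ => ℝ) x =
        ({k} : Finset (Fin n)).restrict (π := fun _ => ℝ) y := by
      funext j
      simp [Finset.mem_singleton.1 j.2, h]
    simp only [hA, mem_preimage, this]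
  have hBdep : ∀ x y : Fin n → ℝ, x i = y i → (x ∈ B ↔ y ∈ B) := fun x y h => by
    have : ({i} : Finset (Fin n)).restrict (π := fun _ => ℝ) x =
        ({i} : Finset (Fin n)).restrict (π := fun _ => ℝ) y := by
      funext j
      simp [Finset.mem_singleton.1 j.2, h]
    simp only [hB, mem_preimage, this]
  -- `H` is the conditional probability of the event `A` given the strict ancestors of `k`
  set H : (Fin n → ℝ) → ℝ≥0∞ := fun v =>
    ∫⁻ x, g (Function.update v k x) * A.indicator 1 (Function.update v k x) ∂γ with hH
  have hHm : Measurable H := Measurable.lintegral_prod_right' (f := fun p : (Fin n → ℝ) × ℝ =>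
    g (Function.update p.1 k p.2) * A.indicator 1 (Function.update p.1 k p.2))
    ((hg.mul (measurable_one.indicator hAm)).comp measurable_update')
  have hHdep : DependsOn H C := by
    intro x y hxy
    refine lintegral_congr fun u => ?_
    have h1 : g (Function.update x k u) = g (Function.update y k u) := hdep <| by
      rintro j (rfl | hj)
      · simp
      · rw [Function.update_of_ne, Function.update_of_ne, hxy j hj] <;>
        · rintro rfl
          exact hkS (hC hj)
    rw [h1, indicator_one_congr (hAdep _ (Function.update y k u) (by simp))]
  have hHeq : ∀ᵐ v ∂M.law, H v =
      ∫⁻ x, A.indicator 1 (Function.update v k x) ∂(M.mechanism k (G.paVal k v)) := by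
    filter_upwards [hmech] with v hv
    rw [hv]
    exact (lintegral_withDensity_eq_lintegral_mul _ (hg.comp (measurable_update _))
      ((measurable_one.indicator hAm).comp (measurable_update _))).symm
  have hH1 : ∀ᵐ v ∂M.law, H v ≤ 1 := by
    filter_upwards [hHeq] with v hv
    rw [hv]
    calc _ ≤ ∫⁻ _, 1 ∂(M.mechanism k (G.paVal k v)) :=
          lintegral_mono fun x => indicator_le_self A (1 : (Fin n → ℝ) → ℝ≥0∞) (Function.update v k x)
      _ = 1 := by simp
  have hHint : Integrable (fun v => (H v).toReal) M.law := by
    refine Integrable.of_bound hHm.ennreal_toReal.aestronglyMeasurable 1 ?_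
    filter_upwards [hH1] with v hv
    rw [Real.norm_of_nonneg ENNReal.toReal_nonneg]
    exact ENNReal.toReal_le_of_le_ofReal zero_le_one (by simpa using hv)
  have hmain : ∀ D : Set (Fin n → ℝ), MeasurableSet D →
      (∀ x y : Fin n → ℝ, (∀ j ∈ G.ancestors k, x j = y j) → (x ∈ D ↔ y ∈ D)) →
      M.law (A ∩ D) = ∫⁻ v in D, H v ∂M.law := by
    intro D hD hDdep
    rw [← lintegral_indicator_one (hAm.inter hD), M.lintegral_law_eq_lintegral_mechanism
      (G.isAncestral_ancestors k) hkS (fun i hi => .single hi)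
      (measurable_one.indicator (hAm.inter hD)), ← lintegral_indicator hD]
    · refine lintegral_congr_ae ?_
      filter_upwards [hHeq] with v hv
      have hupd : ∀ x, Function.update v k x ∈ D ↔ v ∈ D := fun x =>
        hDdep _ _ fun j hj => Function.update_of_ne (by rintro rfl; exact hkS hj) _ _
      by_cases hvD : v ∈ D
      · rw [indicator_of_mem hvD, hv]
        exact lintegral_congr fun x => indicator_one_congr (by simp [hupd, hvD])
      · simp [indicator, hupd, hvD]
    · intro x y h
      have h1 := hAdep x y (h k (mem_insert _ _))
      have h2 := hDdep x y fun j hj => h j (mem_insert_of_mem _ hj)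
      exact indicator_one_congr (and_congr h1 h2)
  have hcond : ∀ D : Set (Fin n → ℝ), MeasurableSet D →
      (∀ x y : Fin n → ℝ, (∀ j ∈ G.ancestors k, x j = y j) → (x ∈ D ↔ y ∈ D)) →
      M.law⟦A ∩ D | coordSigma C⟧ =ᵐ[M.law] M.law[(fun v => (H v).toReal) * D.indicator (fun _ => 1) | coordSigma C] := by
    intro D hD hDdep
    have hmul : (fun v => (H v).toReal) * D.indicator (fun _ => (1 : ℝ)) =
        D.indicator fun v => (H v).toReal := by
      funext v
      by_cases hv : v ∈ D <;> simp [hv]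
    rw [hmul]
    symm
    refine ae_eq_condExp_of_forall_setIntegral_eq hm
      ((integrable_const _).indicator (hAm.inter hD)) (fun T _ _ => integrable_condExp.integrableOn)
      (fun T hT _ => ?_) stronglyMeasurable_condExp.aestronglyMeasurable
    have hTm : MeasurableSet T := hm _ hT
    have hTdep : ∀ x y : Fin n → ℝ, (∀ j ∈ G.ancestors k, x j = y j) → (x ∈ T ↔ y ∈ T) := by
      intro x y h
      obtain ⟨T', _, rfl⟩ := hT
      have : C.restrict (π := fun _ => ℝ) x = C.restrict (π := fun _ => ℝ) y :=
        funext fun j => h j (hC j.2)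
      simp only [mem_preimage, this]
    rw [setIntegral_condExp hm (hHint.indicator hD) hT, integral_indicator hD,
      integral_indicator (hAm.inter hD), Measure.restrict_restrict hD,
      Measure.restrict_restrict (hAm.inter hD), integral_toReal hHm.aemeasurable
        (ae_restrict_of_ae (hH1.mono fun v hv => hv.trans_lt ENNReal.one_lt_top)),
      ← hmain _ (hD.inter hTm) fun x y h => and_congr (hDdep x y h) (hTdep x y h), inter_assoc]
    simp [Measure.real]
  have h1 := hcond univ .univ fun _ _ _ => by simp
  have h2 := hcond B hBm fun x y h => hBdep x y (h i hi)
  have hHsm : StronglyMeasurable[coordSigma C] fun v => (H v).toReal :=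
    (DependsOn.measurable_comap_restrict hHm.ennreal_toReal fun x y h => by
      simp only [hHdep h]).stronglyMeasurable
  rw [inter_univ, indicator_univ] at h1
  have h1' : M.law⟦A | coordSigma C⟧ =ᵐ[M.law] fun v => (H v).toReal := by
    refine h1.trans ?_
    have : (fun v => (H v).toReal) * (fun _ => (1 : ℝ)) = fun v => (H v).toReal := by
      funext v; simp
    rw [this, condExp_of_stronglyMeasurable hm hHsm hHint]
  have h3 : M.law[(fun v => (H v).toReal) * B.indicator (fun _ => 1) | coordSigma C] =ᵐ[M.law]
      (fun v => (H v).toReal) * M.law⟦B | coordSigma C⟧ := by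
    refine condExp_mul_of_stronglyMeasurable_left hHsm ?_
      ((integrable_const _).indicator hBm)
    exact (hHint.indicator hBm).congr (ae_of_all _ fun v => by
      by_cases hv : v ∈ B <;> simp [hv])
  filter_upwards [h1', h2, h3] with v hv1 hv2 hv3
  rw [hv2, hv3, hv1]
  rfl

/-- By faithfulness, the mechanism of `V k` genuinely depends on each parent of `k`: its density
does not agree almost everywhere with a function which does not depend on the coordinate `i`. -/
theorem MultiEnvModel.not_adj_of_mechDensity_ae_eq {n : ℕ} {G : DAG n} {E : Type*}
    (M : MultiEnvModel G E) (γ : Fin n → Measure ℝ) [∀ i, IsProbabilityMeasure (γ i)]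
    (hac : M.obs.law ≪ Measure.pi γ) {i k : Fin n} {D : (Fin n → ℝ) → ℝ≥0∞}
    (hD : M.obs.mechDensity (γ k) k =ᵐ[Measure.pi γ] D)
    (hDi : ∀ v t, D (Function.update v i t) = D v) : ¬ G.Adj i k := by
  classical
  intro hadj
  set p := M.obs.mechDensity (γ k) k with hp
  have hpm : Measurable p := M.obs.measurable_mechDensity (γ k) k
  set C : Finset (Fin n) := Finset.univ.filter fun j => G.Adj j k ∧ j ≠ i with hC
  -- averaging `p` over the coordinate `i` removes the dependence on `i` everywhere
  set g : (Fin n → ℝ) → ℝ≥0∞ := fun v => ∫⁻ t, p (Function.update v i t) ∂(γ i) with hg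
  have hgm : Measurable g := Measurable.lintegral_prod_right' (f := fun q : (Fin n → ℝ) × ℝ =>
    p (Function.update q.1 i q.2)) (hpm.comp measurable_update')
  have hgp : p =ᵐ[Measure.pi γ] g := by
    filter_upwards [hD, ae_ae_update γ i hD] with v hv hv'
    have : g v = ∫⁻ _, p v ∂(γ i) := lintegral_congr_ae <| by
      filter_upwards [hv'] with t ht
      rw [ht, hDi, hv]
    rw [this]
    simp
  have hki := (G.ne_of_adj hadj).symm
  have hgdep : DependsOn g (insert k (C : Set (Fin n))) := by
    intro x y hxy
    refine lintegral_congr fun t => M.obs.dependsOn_mechDensity (γ k) k fun j hj => ?_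
    rcases eq_or_ne j i with rfl | hji
    · simp
    · rw [Function.update_of_ne hji, Function.update_of_ne hji]
      rcases hj with rfl | hj
      · exact hxy _ (mem_insert _ _)
      · exact hxy _ (mem_insert_of_mem _ (by simpa [hC] using ⟨hj, hji⟩))
  refine G.not_dSep_of_adj hadj C (M.obs_faithful _ _ _ (by simpa using hki) (by
    simp [hC, G.not_adj_self]) (by simp [hC]) (M.obs.condIndepCoords_of_mechanism (γ := γ k)
      (.single hadj) (fun j hj => ?_) hgm hgdep ?_))
  · exact .single (by simpa [hC] using hj : _ ∧ _).1
  · filter_upwards [M.obs.mechanism_absolutelyContinuous γ hac k,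
      hac.ae_le (ae_ae_update γ k hgp)] with v hv hv'
    rw [M.obs.mechanism_eq_withDensity hv]
    exact withDensity_congr_ae hv'

/-! ### Recovering the coordinates -/

theorem MeasureTheory.Measure.withDensity_map {X Y : Type*} [MeasurableSpace X]
    [MeasurableSpace Y] (μ : Measure X) {ψ : X → Y} (hψ : Measurable ψ) {g : Y → ℝ≥0∞}
    (hg : Measurable g) : (μ.map ψ).withDensity g = (μ.withDensity (g ∘ ψ)).map ψ := by
  ext s hs
  rw [withDensity_apply _ hs, setLIntegral_map hs hg hψ, Measure.map_apply hψ hs,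
    withDensity_apply _ (hψ hs)]
  rfl

theorem HasC1FullySupportedDensity.absolutelyContinuous {n : ℕ} {P : Measure (Fin n → ℝ)}
    (h : HasC1FullySupportedDensity P) : P ≪ volume := by
  obtain ⟨p, _, _, hp⟩ := h
  rw [hp.eq_withDensity]
  exact withDensity_absolutelyContinuous _ _

theorem HasC1FullySupportedDensity.volume_absolutelyContinuous {n : ℕ} {P : Measure (Fin n → ℝ)}
    (h : HasC1FullySupportedDensity P) : volume ≪ P := by
  obtain ⟨p, _, hpos, hp⟩ := h
  rw [hp.eq_withDensity]
  exact withDensity_absolutelyContinuous' hp.measurable.ennreal_ofReal.aemeasurable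
    (ae_of_all _ fun v => by simpa using hpos v)

theorem injective_of_deriv_ne_zero {r : ℝ → ℝ}
    (h : ∀ v, DifferentiableAt ℝ r v ∧ deriv r v ≠ 0) : Function.Injective r := by
  have hc : Continuous r := continuous_iff_continuousAt.2 fun v => (h v).1.continuousAt
  have key : ∀ x y, x < y → r x ≠ r y := fun x y hxy heq => by
    obtain ⟨c, _, hc⟩ := exists_deriv_eq_zero hxy hc.continuousOn heq
    exact (h c).2 hc
  intro x y hxy
  by_contra hne
  rcases lt_or_gt_of_ne hne with hlt | hlt
  · exact key x y hlt hxy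
  · exact key y x hlt hxy.symm

/-- If a pair of environments is a pair of interventions on node `i` of the first model, with
mechanisms whose ratio is strictly monotone, and on node `k` of the second, then latent `i` of the
first model is a function of latent `k` of the second: the likelihood ratio of the two
environments is a function of either of them. -/
theorem dependsOn_of_isPairOn {n : ℕ} {G G' : DAG n} {E : Type*} (M : MultiEnvModel G E)
    (N : MultiEnvModel G' E) (γ : Fin n → Measure ℝ) [∀ i, IsProbabilityMeasure (γ i)]
    [∀ i, (γ i).IsOpenPosMeasure] {ψ χ : (Fin n → ℝ) → (Fin n → ℝ)} (hψ : Continuous ψ)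
    (hχ : Continuous χ) (hχψ : ∀ v, χ (ψ v) = v) {e e' : E}
    (hM : (M.env e).law ≪ Measure.pi γ) (hM' : (M.env e').law ≪ Measure.pi γ)
    (hN : (N.env e).law ≪ Measure.pi γ) (hN' : (N.env e').law ≪ Measure.pi γ)
    (hπ : Measure.pi γ ≪ (N.env e).law)
    (hQ : (N.env e).law = (M.env e).law.map ψ) (hQ' : (N.env e').law = (M.env e').law.map ψ)
    {i k : Fin n} (hMi : M.IsPairOn e e' i) (hNk : N.IsPairOn e e' k)
    (hdist : M.DistinctMechanisms e e' i) : DependsOn (fun z => χ z i) {k} := by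
  obtain ⟨a, b, ha, hb, hα, hβ, hab⟩ := hdist
  have hinj := injective_of_deriv_ne_zero hab
  set r : ℝ → ℝ := fun t => b t / a t with hr
  have hrc : Continuous r := continuous_iff_continuousAt.2 fun v => (hab v).1.continuousAt
  have hrpos : ∀ t, 0 < r t := fun t => div_pos (hb t) (ha t)
  have hρm : Measurable fun t => ENNReal.ofReal (r t) := hrc.measurable.ennreal_ofReal
  -- the likelihood ratio of the two environments in terms of the first model
  have h1 : (M.env e').law = (M.env e).law.withDensity fun v => ENNReal.ofReal (r (v i)) := by
    refine M.law_env_eq_withDensity γ hMi hM hM' (ρ := fun t => ENNReal.ofReal (r t))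
      (α := volume.withDensity fun t => ENNReal.ofReal (a t))
      (β := volume.withDensity fun t => ENNReal.ofReal (b t)) (fun w => (hα w).eq_withDensity)
      (fun w => (hβ w).eq_withDensity) hρm ?_
    rw [← withDensity_mul _ (hα 0).measurable.ennreal_ofReal hρm]
    congr 1
    funext t
    rw [Pi.mul_apply, ← ENNReal.ofReal_mul (ha t).le, hr, mul_div_cancel₀ _ (ha t).ne']
  have hgm : Measurable fun z => ENNReal.ofReal (r (χ z i)) :=
    hρm.comp ((measurable_pi_apply i).comp hχ.measurable)
  have h2 : (N.env e').law = (N.env e).law.withDensity fun z => ENNReal.ofReal (r (χ z i)) := by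
    rw [hQ, Measure.withDensity_map _ hψ.measurable hgm, hQ', h1]
    simp only [Function.comp_def, hχψ]
  -- the likelihood ratio of the two environments in terms of the second model
  set α' := (N.env e).mechanism k 0 with hα'
  set β' := (N.env e').mechanism k 0 with hβ'
  have hα'c : ∀ w, (N.env e).mechanism k w = α' := fun w => N.perfect e k (by simp [hNk.1]) w 0
  have hβ'c : ∀ w, (N.env e').mechanism k w = β' := fun w => N.perfect e' k (by simp [hNk.2]) w 0
  have hac : β' ≪ α' := by
    rw [← (N.env e).law_map_eval hα'c, ← (N.env e').law_map_eval hβ'c]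
    exact (hN'.trans hπ).map (measurable_pi_apply k)
  have hρ'm := Measure.measurable_rnDeriv β' α'
  have h3 := N.law_env_eq_withDensity γ hNk hN hN' hα'c hβ'c hρ'm
    (Measure.withDensity_rnDeriv_eq _ _ hac).symm
  have h4 : (fun z => ENNReal.ofReal (r (χ z i))) =ᵐ[(N.env e).law]
      fun z => β'.rnDeriv α' (z k) := by
    refine (withDensity_eq_iff hgm.aemeasurable
      (hρ'm.comp (measurable_pi_apply k)).aemeasurable ?_).1 (h2 ▸ h3)
    rw [← setLIntegral_univ, ← withDensity_apply _ .univ, ← h2]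
    exact measure_ne_top _ _
  have h5 : (fun z => r (χ z i)) =ᵐ[Measure.pi γ] fun z => (β'.rnDeriv α' (z k)).toReal := by
    filter_upwards [hπ.ae_le h4] with z hz
    rw [← hz, ENNReal.toReal_ofReal (hrpos _).le]
  have hRc : Continuous fun z => r (χ z i) := hrc.comp ((continuous_apply i).comp hχ)
  refine dependsOn_of_forall_update fun l hl v t => hinj ?_
  refine hRc.update_eq_of_ae_eq γ h5 (fun v t => ?_) v t
  rw [Function.update_of_ne (Ne.symm (by simpa using hl))]

/-- If each coordinate of the inverse of a diffeomorphism `ψ` of `ℝⁿ` is a function of a single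
coordinate, then `ψ` is a permutation of the coordinates composed with an element-wise
diffeomorphism. -/
theorem exists_perm_diffeomorph {n : ℕ} {ψ χ : (Fin n → ℝ) → (Fin n → ℝ)} (hψ : ContDiff ℝ 1 ψ)
    (hχ : ContDiff ℝ 1 χ) (hχψ : ∀ v, χ (ψ v) = v) (hψχ : ∀ z, ψ (χ z) = z) (κ : Fin n → Fin n)
    (hκ : ∀ i, DependsOn (fun z => χ z i) {κ i}) :
    ∃ (σ : Equiv.Perm (Fin n)) (φ : Fin n → Diffeomorph 𝓘(ℝ, ℝ) 𝓘(ℝ, ℝ) ℝ ℝ 1),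
      (∀ i, σ i = κ i) ∧ ∀ v i, ψ v (σ i) = φ i (v i) := by
  have hχinj : Function.Injective χ := Function.LeftInverse.injective hψχ
  -- a coordinate outside the range of `κ` would not influence `χ`
  have hsurj : Function.Surjective κ := by
    intro l
    by_contra! hl
    have : Function.update (0 : Fin n → ℝ) l 1 = 0 :=
      hχinj <| funext fun i => (hκ i).apply_update (by simpa using (hl i).symm) 0 1
    simpa using congrFun this l
  have hinj : Function.Injective κ := Finite.injective_iff_surjective.2 hsurj
  set g : Fin n → ℝ → ℝ := fun i t => χ (Function.update 0 (κ i) t) i with hg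
  have hχg : ∀ z i, χ z i = g i (z (κ i)) := fun z i => hκ i (by simp)
  have hginj : ∀ i, Function.Injective (g i) := by
    intro i s t hst
    have : Function.update (0 : Fin n → ℝ) (κ i) s =
        Function.update (0 : Fin n → ℝ) (κ i) t := by
      refine hχinj (funext fun j => ?_)
      rcases eq_or_ne j i with rfl | hj
      · exact hst
      · refine hκ j ?_
        simp [hinj.ne hj]
    simpa using congrFun this (κ i)
  set φ : Fin n → ℝ → ℝ := fun i s => ψ (Function.update 0 i s) (κ i) with hφ
  have hgψ : ∀ v i, g i (ψ v (κ i)) = v i := fun v i => by rw [← hχg, hχψ]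
  have hgφ : ∀ i s, g i (φ i s) = s := fun i s => by simp [hφ, hgψ]
  have hgC : ∀ i, ContDiff ℝ 1 (g i) := fun i =>
    (contDiff_apply ℝ ℝ i).comp (hχ.comp (contDiff_update 1 0 (κ i)))
  have hφC : ∀ i, ContDiff ℝ 1 (φ i) := fun i =>
    (contDiff_apply ℝ ℝ (κ i)).comp (hψ.comp (contDiff_update 1 0 i))
  refine ⟨Equiv.ofBijective κ ⟨hinj, hsurj⟩, fun i =>
    { toFun := φ i
      invFun := g i
      left_inv := hgφ i
      right_inv := fun t => hginj i (hgφ i (g i t))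
      contMDiff_toFun := (hφC i).contMDiff
      contMDiff_invFun := (hgC i).contMDiff }, fun i => rfl, fun v i => ?_⟩
  exact hginj i ((hgψ v i).trans (hgφ i (v i)).symm)

/-! ### Recovering the graph -/

/-- Two families of at least two numbers agree if all their products with one factor left out do. -/
theorem eq_of_forall_mul_prod_erase_eq {n : ℕ} (hn : 2 ≤ n) {a p q : Fin n → ℝ≥0∞}
    (h : ∀ i, a i * ∏ j ∈ Finset.univ.erase i, p j = a i * ∏ j ∈ Finset.univ.erase i, q j)
    (h0 : ∀ i, a i * ∏ j ∈ Finset.univ.erase i, p j ≠ 0)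
    (htop : ∀ i, a i * ∏ j ∈ Finset.univ.erase i, p j ≠ ∞) : p = q := by
  have : Nontrivial (Fin n) := Fin.nontrivial_iff_two_le.2 hn
  have ha0 : ∀ i, a i ≠ 0 := fun i hi => h0 i (by simp [hi])
  have hprod0 : ∀ i, ∏ j ∈ Finset.univ.erase i, p j ≠ 0 := fun i hi => h0 i (by simp [hi])
  have hatop : ∀ i, a i ≠ ∞ := fun i hi => htop i (by rw [hi, ENNReal.top_mul (hprod0 i)])
  have hprodtop : ∀ i, ∏ j ∈ Finset.univ.erase i, p j ≠ ∞ := fun i hi =>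
    htop i (by rw [hi, ENNReal.mul_top (ha0 i)])
  have heq : ∀ i, ∏ j ∈ Finset.univ.erase i, p j = ∏ j ∈ Finset.univ.erase i, q j := fun i =>
    (ENNReal.mul_right_inj (ha0 i) (hatop i)).1 (h i)
  have hfac : ∀ (f : Fin n → ℝ≥0∞), (∀ i, ∏ j ∈ Finset.univ.erase i, f j ≠ 0) →
      (∀ i, ∏ j ∈ Finset.univ.erase i, f j ≠ ∞) → ∀ j, f j ≠ 0 ∧ f j ≠ ∞ := by
    intro f hf0 hftop j
    obtain ⟨i, hij⟩ := exists_ne j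
    have hj : j ∈ Finset.univ.erase i := Finset.mem_erase.2 ⟨hij.symm, Finset.mem_univ j⟩
    have hne : ∀ l ∈ Finset.univ.erase i, f l ≠ 0 := Finset.prod_ne_zero_iff.1 (hf0 i)
    refine ⟨hne j hj, fun hjtop => hftop i ?_⟩
    rw [← Finset.mul_prod_erase _ _ hj, hjtop, ENNReal.top_mul]
    exact Finset.prod_ne_zero_iff.2 fun l hl => hne l (Finset.mem_of_mem_erase hl)
  have hp := hfac p hprod0 hprodtop
  have hq := hfac q (fun i => heq i ▸ hprod0 i) (fun i => heq i ▸ hprodtop i)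
  -- every factor occurs `n - 1` times in the product of all the products
  have hpow : ∀ (f : Fin n → ℝ≥0∞), ∏ i, ∏ j ∈ Finset.univ.erase i, f j = (∏ j, f j) ^ (n - 1) := by
    intro f
    have : ∀ i, ∏ j ∈ Finset.univ.erase i, f j = ∏ j, if j = i then 1 else f j := fun i => by
      rw [← Finset.mul_prod_erase _ (fun j => if j = i then 1 else f j) (Finset.mem_univ i),
        if_pos rfl, one_mul]
      exact Finset.prod_congr rfl fun j hj => (if_neg (Finset.ne_of_mem_erase hj)).symm
    simp_rw [this]
    rw [Finset.prod_comm, ← Finset.prod_pow]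
    refine Finset.prod_congr rfl fun j _ => ?_
    rw [← Finset.mul_prod_erase _ _ (Finset.mem_univ j), if_pos rfl, one_mul,
      Finset.prod_congr rfl fun i hi => if_neg (Finset.ne_of_mem_erase hi).symm]
    simp
  have hall : ∏ j, p j = ∏ j, q j := by
    have : (∏ j, p j) ^ (n - 1) = (∏ j, q j) ^ (n - 1) := by
      rw [← hpow, ← hpow]
      exact Finset.prod_congr rfl fun i _ => heq i
    exact (ENNReal.pow_right_strictMono (by omega : n - 1 ≠ 0)).injective this
  funext k
  rw [← Finset.mul_prod_erase _ _ (Finset.mem_univ k),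
    ← Finset.mul_prod_erase _ _ (Finset.mem_univ k), ← heq k] at hall
  exact (ENNReal.mul_left_inj (hprod0 k) (hprodtop k)).1 hall

/-- The image of a product measure under a permutation of the coordinates composed with an
element-wise map. -/
theorem pi_map_eq_map_pi {n : ℕ} (γ γ' : Fin n → Measure ℝ) [∀ i, IsProbabilityMeasure (γ i)]
    [∀ i, IsProbabilityMeasure (γ' i)] {ψ : (Fin n → ℝ) → (Fin n → ℝ)} (hψ : Measurable ψ)
    (σ : Equiv.Perm (Fin n)) {φ : Fin n → ℝ → ℝ} (hφ : ∀ i, Measurable (φ i))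
    (hψφ : ∀ v i, ψ v (σ i) = φ i (v i)) (hγ' : ∀ i, γ' (σ i) = (γ i).map (φ i)) :
    Measure.pi γ' = (Measure.pi γ).map ψ := by
  refine Measure.pi_eq fun s hs => ?_
  rw [Measure.map_apply hψ (MeasurableSet.univ_pi hs)]
  have : ψ ⁻¹' univ.pi s = univ.pi fun i => φ i ⁻¹' s (σ i) := by
    ext v
    simp only [mem_preimage, mem_pi, mem_univ, true_imp_iff, ← hψφ]
    exact ⟨fun H i => H (σ i), fun H k => by simpa using H (σ.symm k)⟩
  rw [this, Measure.pi_pi, ← Equiv.prod_comp σ fun k => γ' k (s k)]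
  exact Finset.prod_congr rfl fun i _ => by rw [hγ', Measure.map_apply (hφ i) (hs _)]

theorem volume_absolutelyContinuous_map {n : ℕ} {ψ : (Fin n → ℝ) → (Fin n → ℝ)}
    (hψ : ContDiff ℝ 1 ψ) (hsurj : Function.Surjective ψ) :
    (volume : Measure (Fin n → ℝ)) ≪ volume.map ψ := by
  refine Measure.AbsolutelyContinuous.mk fun s hs h => ?_
  rw [Measure.map_apply hψ.continuous.measurable hs] at h
  rw [← image_preimage_eq s hsurj]
  exact addHaar_image_eq_zero_of_differentiableOn_of_addHaar_eq_zero _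
    (hψ.differentiable one_ne_zero).differentiableOn h

/-- If the latents of two models correspond to each other under `ψ`, a permutation `σ` of the
coordinates composed with an element-wise map, and each node `i` is the single target of an
environment of the first model whose target in the second model is `σ i`, then the two models have
the same mechanism densities. -/
theorem mechDensity_ae_eq {n : ℕ} (hn : 2 ≤ n) {G G' : DAG n} {E : Type*} (M : MultiEnvModel G E)
    (N : MultiEnvModel G' E) (γ γ' : Fin n → Measure ℝ) [∀ i, IsProbabilityMeasure (γ i)]
    [∀ i, IsProbabilityMeasure (γ' i)] {ψ χ : (Fin n → ℝ) → (Fin n → ℝ)} (hψ : Measurable ψ)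
    (hχ : Measurable χ) (hχψ : ∀ v, χ (ψ v) = v) (σ : Equiv.Perm (Fin n)) (φ : Fin n → ℝ ≃ᵐ ℝ)
    (hψφ : ∀ v i, ψ v (σ i) = φ i (v i)) (hγ' : ∀ i, γ' (σ i) = (γ i).map (φ i))
    {e : Fin n → E} (hMe : ∀ i, M.target (e i) = {i}) (hNe : ∀ i, N.target (e i) = {σ i})
    (hM : ∀ i, (M.env (e i)).law ≪ Measure.pi γ) (hM' : ∀ i, Measure.pi γ ≪ (M.env (e i)).law)
    (hN : ∀ i, (N.env (e i)).law = (M.env (e i)).law.map ψ) (k : Fin n) :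
    M.obs.mechDensity (γ k) k =ᵐ[Measure.pi γ]
      fun v => N.obs.mechDensity (γ' (σ k)) (σ k) (ψ v) := by
  have hπ := pi_map_eq_map_pi γ γ' hψ σ (fun i => (φ i).measurable) hψφ hγ'
  have hpm := fun j => M.obs.measurable_mechDensity (γ j) j
  have hqm := fun j => N.obs.measurable_mechDensity (γ' j) j
  have key : ∀ i, ∃ a : ℝ → ℝ≥0∞, ∀ᵐ v ∂(Measure.pi γ),
      (a (v i) * ∏ j ∈ Finset.univ.erase i, M.obs.mechDensity (γ j) j v =
        a (v i) * ∏ j ∈ Finset.univ.erase i, N.obs.mechDensity (γ' (σ j)) (σ j) (ψ v)) ∧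
      a (v i) * ∏ j ∈ Finset.univ.erase i, M.obs.mechDensity (γ j) j v ≠ 0 ∧
      a (v i) * ∏ j ∈ Finset.univ.erase i, M.obs.mechDensity (γ j) j v ≠ ∞ := by
    intro i
    set α := (M.env (e i)).mechanism i 0 with hα
    have hαc : ∀ w, (M.env (e i)).mechanism i w = α :=
      fun w => M.perfect (e i) i (by simp [hMe]) w 0
    set β := (N.env (e i)).mechanism (σ i) 0 with hβ
    have hβc : ∀ w, (N.env (e i)).mechanism (σ i) w = β :=
      fun w => N.perfect (e i) (σ i) (by simp [hNe]) w 0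
    have hαγ : α ≪ γ i := by
      rw [← (M.env (e i)).law_map_eval hαc]
      have := (hM i).map (measurable_pi_apply i)
      rwa [(measurePreserving_eval γ i).map_eq] at this
    set a := α.rnDeriv (γ i) with ha
    have ham : Measurable a := Measure.measurable_rnDeriv _ _
    have haα : α = (γ i).withDensity a := (Measure.withDensity_rnDeriv_eq _ _ hαγ).symm
    -- the intervened mechanisms correspond to each other, being the marginals of the two laws
    have hβα : β = α.map (φ i) := by
      rw [← (N.env (e i)).law_map_eval hβc, ← (M.env (e i)).law_map_eval hαc, hN,
        Measure.map_map (measurable_pi_apply _) hψ,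
        Measure.map_map (φ i).measurable (measurable_pi_apply _)]
      congr 1
      exact funext fun v => hψφ v i
    have hbm : Measurable fun t => a ((φ i).symm t) := ham.comp (φ i).symm.measurable
    have hbβ : β = (γ' (σ i)).withDensity fun t => a ((φ i).symm t) := by
      rw [hγ', Measure.withDensity_map _ (φ i).measurable hbm, hβα, haα]
      simp [Function.comp_def]
    have h1 := M.law_env_eq_withDensity_prod γ (hMe i) (hM i) hαc ham haα
    have hN' : (N.env (e i)).law ≪ Measure.pi γ' := by
      rw [hN, hπ]
      exact (hM i).map hψ
    have h2 := N.law_env_eq_withDensity_prod γ' (hNe i) hN' hβc hbm hbβ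
    have hPm : Measurable fun v => a (v i) * ∏ j ∈ Finset.univ.erase i,
        M.obs.mechDensity (γ j) j v :=
      (ham.comp (measurable_pi_apply i)).mul (Finset.measurable_fun_prod _ fun j _ => hpm j)
    have hQm : Measurable fun z => a ((φ i).symm (z (σ i))) * ∏ k ∈ Finset.univ.erase (σ i),
        N.obs.mechDensity (γ' k) k z :=
      (hbm.comp (measurable_pi_apply (σ i))).mul (Finset.measurable_fun_prod _ fun j _ => hqm j)
    have hQ : ((fun z => a ((φ i).symm (z (σ i))) * ∏ k ∈ Finset.univ.erase (σ i),
        N.obs.mechDensity (γ' k) k z) ∘ ψ) = fun v => a (v i) * ∏ j ∈ Finset.univ.erase i,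
          N.obs.mechDensity (γ' (σ j)) (σ j) (ψ v) := by
      funext v
      simp only [Function.comp_apply, hψφ, MeasurableEquiv.symm_apply_apply]
      congr 1
      refine (Finset.prod_bij (fun j _ => σ j) ?_ ?_ ?_ ?_).symm
      · simp
      · simp
      · intro k hk
        exact ⟨σ.symm k, by simpa [Equiv.symm_apply_eq] using hk, by simp⟩
      · simp
    have h3 : (M.env (e i)).law = (Measure.pi γ).withDensity fun v => a (v i) *
        ∏ j ∈ Finset.univ.erase i, N.obs.mechDensity (γ' (σ j)) (σ j) (ψ v) := by
      rw [hN, hπ, Measure.withDensity_map _ hψ hQm, hQ] at h2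
      have h4 := congrArg (Measure.map χ) h2
      have hid : χ ∘ ψ = id := funext hχψ
      rwa [Measure.map_map hχ hψ, Measure.map_map hχ hψ, hid, Measure.map_id,
        Measure.map_id] at h4
    have hint : ∫⁻ v, a (v i) * ∏ j ∈ Finset.univ.erase i, M.obs.mechDensity (γ j) j v
        ∂(Measure.pi γ) ≠ ∞ := by
      rw [← setLIntegral_univ, ← withDensity_apply _ .univ, ← h1]
      exact measure_ne_top _ _
    have heq := (withDensity_eq_iff hPm.aemeasurable (hQ ▸ hQm.comp hψ).aemeasurable hint).1
      (h1.symm.trans h3)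
    have hne : ∀ᵐ v ∂(Measure.pi γ),
        a (v i) * ∏ j ∈ Finset.univ.erase i, M.obs.mechDensity (γ j) j v ≠ 0 := by
      refine (hM' i).ae_le ?_
      rw [h1]
      exact (ae_withDensity_iff hPm).2 (ae_of_all _ fun v hv => hv)
    refine ⟨a, ?_⟩
    filter_upwards [heq, hne, ae_lt_top hPm hint] with v h1 h2 h3
    exact ⟨h1, h2, h3.ne⟩
  choose a ha using key
  filter_upwards [ae_all_iff.2 ha] with v hv
  exact congrFun (eq_of_forall_mul_prod_erase_eq hn (a := fun i => a i (v i))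
    (p := fun j => M.obs.mechDensity (γ j) j v)
    (q := fun j => N.obs.mechDensity (γ' (σ j)) (σ j) (ψ v))
    (fun i => (hv i).1) (fun i => (hv i).2.1) (fun i => (hv i).2.2)) k

/-- A permutation of the nodes is a graph isomorphism as soon as it identifies the mechanism
densities: by faithfulness the parents of a node are the coordinates on which its mechanism
depends. -/
theorem adj_iff_adj_of_mechDensity_ae_eq {n : ℕ} {G G' : DAG n} {E : Type*}
    (M : MultiEnvModel G E) (N : MultiEnvModel G' E) (γ γ' : Fin n → Measure ℝ)
    [∀ i, IsProbabilityMeasure (γ i)] [∀ i, IsProbabilityMeasure (γ' i)]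
    {ψ χ : (Fin n → ℝ) → (Fin n → ℝ)} (hψ : Measurable ψ) (hχ : Measurable χ)
    (hχψ : ∀ v, χ (ψ v) = v) (hψχ : ∀ z, ψ (χ z) = z) (σ : Equiv.Perm (Fin n))
    (φ : Fin n → ℝ ≃ᵐ ℝ) (hψφ : ∀ v i, ψ v (σ i) = φ i (v i))
    (hπ : Measure.pi γ' = (Measure.pi γ).map ψ) (hM : M.obs.law ≪ Measure.pi γ)
    (hN : N.obs.law ≪ Measure.pi γ') {i k : Fin n} (hik : i ≠ k)
    (hk : M.obs.mechDensity (γ k) k =ᵐ[Measure.pi γ]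
      fun v => N.obs.mechDensity (γ' (σ k)) (σ k) (ψ v)) :
    G.Adj i k ↔ G'.Adj (σ i) (σ k) := by
  have hσ : σ i ≠ σ k := σ.injective.ne hik
  have hψupd : ∀ v t, ψ (Function.update v i t) = Function.update (ψ v) (σ i) (φ i t) := by
    intro v t
    funext l
    obtain ⟨j, rfl⟩ := σ.surjective l
    rcases eq_or_ne j i with rfl | hj
    · simp [hψφ]
    · simp [hψφ, hj]
  have hχupd : ∀ z t, χ (Function.update z (σ i) t) =
      Function.update (χ z) i ((φ i).symm t) := by
    intro z t
    rw [← hχψ (Function.update (χ z) i ((φ i).symm t)), hψupd, hψχ,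
      MeasurableEquiv.apply_symm_apply]
  have hk' : N.obs.mechDensity (γ' (σ k)) (σ k) =ᵐ[Measure.pi γ']
      fun z => M.obs.mechDensity (γ k) k (χ z) := by
    rw [hπ]
    have hset : MeasurableSet {z | N.obs.mechDensity (γ' (σ k)) (σ k) z =
        M.obs.mechDensity (γ k) k (χ z)} :=
      measurableSet_eq_fun (N.obs.measurable_mechDensity _ _)
        ((M.obs.measurable_mechDensity _ _).comp hχ)
    refine (ae_map_iff hψ.aemeasurable hset).2 ?_
    filter_upwards [hk] with v hv
    rw [hχψ, hv]
  constructor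
  · intro hadj
    by_contra hnot
    refine M.not_adj_of_mechDensity_ae_eq γ hM hk (fun v t => ?_) hadj
    rw [hψupd]
    exact (N.obs.dependsOn_mechDensity _ _).apply_update (by simp [hσ, hnot]) _ _
  · intro hadj
    by_contra hnot
    refine N.not_adj_of_mechDensity_ae_eq γ' hN hk' (fun z t => ?_) hadj
    rw [hχupd]
    exact (M.obs.dependsOn_mechDensity _ _).apply_update (by simp [hik, hnot]) _ _

/-! ### Identifiability -/

theorem mainTheorem2 {n d m : ℕ} {E : Type*}
    -- the ground truth: mixing function, causal graph, latent models and observed distributions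
    (f : (Fin n → ℝ) → (Fin d → ℝ)) (hf : IsDiffeoOntoImage f)
    (G : DAG n) (M : MultiEnvModel G E)
    (PX : E → Measure (Fin d → ℝ)) (hPX : ∀ e, PX e = (M.env e).law.map f)
    -- the candidate: the inferred latent distributions satisfy the same assumptions over `G'`
    (h : (Fin d → ℝ) → (Fin n → ℝ)) (hh : IsUnmixing (range f) h)
    (G' : DAG n) (N : MultiEnvModel G' E)
    (hN : ∀ e, (N.env e).law = (PX e).map h)
    -- (A1)
    (hp : ∀ e, HasC1FullySupportedDensity (M.env e).law)
    (hq : ∀ e, HasC1FullySupportedDensity (N.env e).law)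
    -- (A2') known pairs of environments, with unknown targets shared within each pair
    (e e' : Fin m → E)
    (hpairM : ∀ j, ∃ i, M.IsPairOn (e j) (e' j) i)
    (hpairN : ∀ j, ∃ k, N.IsPairOn (e j) (e' j) k)
    -- (A2'), (A3') every node is the target of a pair whose two mechanisms differ everywhere
    (hA : ∀ i, ∃ j, M.IsPairOn (e j) (e' j) i ∧ M.DistinctMechanisms (e j) (e' j) i) :
    CRLEquiv (range f) (Function.invFun f, G) (h, G') := by
  obtain ⟨g, hg, hgf, hhg⟩ := hh
  have hff : ∀ v, Function.invFun f (f v) = v := Function.leftInverse_invFun hf.injective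
  have hgg : ∀ z, Function.invFun g (g z) = z := Function.leftInverse_invFun hg.injective
  -- the change of latent coordinates and its inverse
  set ψ : (Fin n → ℝ) → (Fin n → ℝ) := fun v => Function.invFun g (f v) with hψdef
  set χ : (Fin n → ℝ) → (Fin n → ℝ) := fun z => Function.invFun f (g z) with hχdef
  have hψ : ContDiff ℝ 1 ψ := hg.contDiffOn_inv.comp_contDiff hf.contDiff fun v => hgf ▸ ⟨v, rfl⟩
  have hχ : ContDiff ℝ 1 χ := hf.contDiffOn_inv.comp_contDiff hg.contDiff fun z => hgf ▸ ⟨z, rfl⟩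
  have hgψ : ∀ v, g (ψ v) = f v := fun v => by
    obtain ⟨z, hz⟩ : f v ∈ range g := hgf ▸ ⟨v, rfl⟩
    simp only [hψdef, ← hz, hgg]
  have hfχ : ∀ z, f (χ z) = g z := fun z => by
    obtain ⟨v, hv⟩ : g z ∈ range f := hgf ▸ ⟨z, rfl⟩
    simp only [hχdef, ← hv, hff]
  have hχψ : ∀ v, χ (ψ v) = v := fun v => by rw [hχdef]; simp only [hgψ, hff]
  have hψχ : ∀ z, ψ (χ z) = z := fun z => by rw [hψdef]; simp only [hfχ, hgg]
  have hhf : ∀ v, h (f v) = ψ v := fun v => by rw [← hgψ, hhg]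
  have hψm := hψ.continuous.measurable
  have hχm := hχ.continuous.measurable
  have hlaw : ∀ e, (N.env e).law = (M.env e).law.map ψ := by
    intro e
    -- `h` need not be measurable off `range f`, where `PX e` has no mass
    have hhm : AEMeasurable h ((M.env e).law.map f) := by
      refine (hf.contDiff.continuous.measurable.measurableEmbedding
        hf.injective).aemeasurable_map_iff.2 ?_
      rw [show h ∘ f = ψ from funext hhf]
      exact hψm.aemeasurable
    rw [hN, hPX, AEMeasurable.map_map_of_aemeasurable hhm
      hf.contDiff.continuous.measurable.aemeasurable]
    congr 1
    exact funext hhf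
  obtain ⟨γ, _, _, hvγ, hγv⟩ := exists_pi_equivalent_volume n
  have hPπ : ∀ e, (M.env e).law ≪ Measure.pi γ := fun e => (hp e).absolutelyContinuous.trans hvγ
  have hQπ : ∀ e, (N.env e).law ≪ Measure.pi γ := fun e => (hq e).absolutelyContinuous.trans hvγ
  choose J hJ hJdist using hA
  choose κ hκ using fun i => hpairN (J i)
  have hdep : ∀ i, DependsOn (fun z => χ z i) {κ i} := fun i =>
    dependsOn_of_isPairOn M N γ hψ.continuous hχ.continuous hχψ (hPπ _) (hPπ _) (hQπ _) (hQπ _)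
      (hγv.trans (hq _).volume_absolutelyContinuous) (hlaw _) (hlaw _) (hJ i) (hκ i) (hJdist i)
  obtain ⟨σ, φ, hσ, hφ⟩ := exists_perm_diffeomorph hψ hχ hχψ hψχ κ hdep
  refine ⟨σ, φ, fun i k => ?_, ?_⟩
  · rcases eq_or_ne i k with rfl | hik
    · exact iff_of_false (G.not_adj_self i) (G'.not_adj_self _)
    have hn : 2 ≤ n := Fin.nontrivial_iff_two_le.1 ⟨⟨i, k, hik⟩⟩
    set Φ : Fin n → ℝ ≃ᵐ ℝ := fun i => (φ i).toHomeomorph.toMeasurableEquiv with hΦ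
    have hψΦ : ∀ v i, ψ v (σ i) = Φ i (v i) := hφ
    set γ' : Fin n → Measure ℝ := fun k => (γ (σ.symm k)).map (Φ (σ.symm k)) with hγ'
    have hγ'σ : ∀ i, γ' (σ i) = (γ i).map (Φ i) := fun i => by simp only [hγ', σ.symm_apply_apply]
    have hprob : ∀ i, IsProbabilityMeasure (γ' i) := fun i =>
      Measure.isProbabilityMeasure_map (Φ (σ.symm i)).measurable.aemeasurable
    have hπ := pi_map_eq_map_pi γ γ' hψm σ (fun i => (Φ i).measurable) hψΦ hγ'σ
    have hNobs : N.obs.law ≪ Measure.pi γ' := by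
      rw [hπ]
      exact (N.obs_absolutelyContinuous.trans
        (volume_absolutelyContinuous_map hψ fun z => ⟨χ z, hψχ z⟩)).trans (hvγ.map hψm)
    exact adj_iff_adj_of_mechDensity_ae_eq M N γ γ' hψm hχm hχψ hψχ σ Φ hψΦ hπ
      (M.obs_absolutelyContinuous.trans hvγ) hNobs hik
      (mechDensity_ae_eq hn M N γ γ' hψm hχm hχψ σ Φ hψΦ hγ'σ (e := fun i => e (J i))
        (fun i => (hJ i).1) (fun i => by rw [hσ]; exact (hκ i).1) (fun i => hPπ _)
        (fun i => hγv.trans (hp _).volume_absolutelyContinuous) (fun i => hlaw _) k)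
  · rintro _ ⟨v, rfl⟩ i
    change h (f v) (σ i) = φ i (Function.invFun f (f v) i)
    rw [hhf, hff]
    exact hφ v i
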